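/- Let $d\ge 2$ and let $\mathbb H^d$ be hyperbolic space (simply connected, complete, of constant curvature $-1$) with metric $\bar g_{-1}$. Let $a:(0,\infty)\to(0,\infty)$ be twice continuously differentiable with $a(t)\to 0$ as $t\to 0$, and let $M=(0,\infty)\times\mathbb H^d$ carry the Lorentzian metric $g=-dt^2+a(t)^2\,\bar g_{-1}$, time-oriented so that $\partial_t$ is future directed. Assume that there are no particle horizons, i.e. $\int_0^1\frac{1}{a(t)}\,dt=\infty$, and that $a(t)\,e^{\int_t^1\frac{1}{a(t')}\,dt'}\to\infty$ as $t\to 0$. Fix $\bar p\in\mathbb H^d$ and let $(r,\omega)\in(0,\infty)\times\mathbb S^{d-1}$ be spherical normal coordinates of $\mathbb H^d$ centred at $\bar p$, so that $\bar g_{-1}=dr^2+\sinh^2(r)\,g_{\mathbb S^{d-1}}$; here $\mathbb S^{d-1}$ is the unit sphere of $T_{\bar p}\mathbb H^d$. Put $\tau(t):=\int_1^t\frac{1}{a(t')}\,dt'$, $u:=r+\tau$ and $\Sigma_{t_0}:=\{t=t_0\}$. Let $\gamma_i:(0,1]\to M$, $i=1,2$, be future directed, past inextendible (piecewise smooth)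 timelike curves parametrised by the time coordinate $t$ such that $$\lim_{s\to 0}u(\gamma_i(s))\in\mathbb R\quad(i=1,2),\qquad \lim_{s\to 0}\omega(\gamma_i(s))=\omega_i\in\mathbb S^{d-1},\qquad \omega_1\neq\omega_2 .$$ Let $q\in M$ satisfy $\gamma_i((0,1])\subseteq M\setminus J^-(q,M)$ for $i=1,2$, where $J^-(q,M)$ consists of $q$ and all points from which there is a future directed (piecewise $C^1$) causal curve to $q$. Then $$d_{\Sigma_{t_0}\setminus J^-(q,M)}\big(\gamma_1(t_0),\gamma_2(t_0)\big)\to\infty\quad\text{as } t_0\to 0,$$ where $d_{\Sigma_{t_0}\setminus J^-(q,M)}$ is the Riemannian distance in $\Sigma_{t_0}\setminus J^-(q,M)$ of the metric induced by $g$, i.e. the infimum of the lengths of curves that stay in $\Sigma_{t_0}\setminus J^-(q,M)$. -/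

import Mathlib

open Set Filter Topology MeasureTheory
open scoped ContDiff ENNReal

namespace FLRW

noncomputable section

/-! ### Hyperbolic space (`K = -1`) as the upper unit hyperboloid in Minkowski space -/

/-- Minkowski space `ℝ^{1,d}`; the first factor is the time axis of the ambient space. -/
abbrev Mink (d : ℕ) : Type := ℝ × EuclideanSpace ℝ (Fin d)

/-- The Minkowski inner product `-x₀ y₀ + x₁ y₁ + ⋯ + x_d y_d`. -/
def mink {d : ℕ} (x y : Mink d) : ℝ := -(x.1 * y.1) + inner ℝ x.2 y.2

/-- Hyperbolic space `ℍ^d`, the simply connected complete `d`-dimensional Riemannian manifold of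
constant curvature `-1`: the sheet `⟨x, x⟩ = -1`, `x₀ > 0`, with the Riemannian metric induced by
the Minkowski inner product. -/
def Hyp (d : ℕ) : Set (Mink d) := {x | mink x x = -1 ∧ 0 < x.1}

/-- The unit sphere `𝕊^{d-1}` in the tangent space `T_p ℍ^d = p^⊥`. -/
def unitSphere {d : ℕ} (p : Mink d) : Set (Mink d) := {w | mink p w = 0 ∧ mink w w = 1}

/-- The point `exp_p (r ω)` of `ℍ^d` with spherical normal coordinates `(r, ω)` centred at `p`. -/
def polar {d : ℕ} (p : Mink d) (r : ℝ) (w : Mink d) : Mink d :=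
  Real.cosh r • p + Real.sinh r • w

/-- The radial normal coordinate `r` centred at `p` (the hyperbolic distance to `p`). -/
def radial {d : ℕ} (p x : Mink d) : ℝ := Real.arcosh (-mink p x)

/-- The angular normal coordinate `ω ∈ 𝕊^{d-1}` centred at `p`, meaningful for `x ≠ p`:
the unit tangent vector at `p` pointing towards `x`. -/
def angular {d : ℕ} (p x : Mink d) : Mink d :=
  (Real.sinh (radial p x))⁻¹ • (x - Real.cosh (radial p x) • p)

/-! The next facts record that `(radial p, angular p)` are the coordinates inverse to `polar p`,
and that the metric in them is `dr² + sinh² r g_{𝕊^{d-1}}`. -/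

lemma mink_comm {d : ℕ} (x y : Mink d) : mink x y = mink y x := by
  simp only [mink, real_inner_comm, mul_comm]

lemma mink_add_left {d : ℕ} (x y z : Mink d) : mink (x + y) z = mink x z + mink y z := by
  simp only [mink, Prod.fst_add, Prod.snd_add, inner_add_left]; ring

lemma mink_smul_left {d : ℕ} (c : ℝ) (x z : Mink d) : mink (c • x) z = c * mink x z := by
  simp only [mink, Prod.smul_fst, Prod.smul_snd, real_inner_smul_left, smul_eq_mul]; ring

lemma mink_add_right {d : ℕ} (x y z : Mink d) : mink z (x + y) = mink z x + mink z y := by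
  rw [mink_comm, mink_add_left, mink_comm x, mink_comm y]

lemma mink_smul_right {d : ℕ} (c : ℝ) (x z : Mink d) : mink z (c • x) = c * mink z x := by
  rw [mink_comm, mink_smul_left, mink_comm]

lemma one_le_neg_mink {d : ℕ} {p x : Mink d} (hp : p ∈ Hyp d) (hx : x ∈ Hyp d) :
    1 ≤ -mink p x := by
  obtain ⟨hp1, hp2⟩ := hp
  obtain ⟨hx1, hx2⟩ := hx
  simp only [mink, real_inner_self_eq_norm_sq] at hp1 hx1 ⊢
  have h := real_inner_le_norm p.2 x.2
  have h3 := mul_pos hp2 hx2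
  have h1 := norm_nonneg p.2
  have h2 := norm_nonneg x.2
  have h4 : (1 + ‖p.2‖ * ‖x.2‖) ^ 2 ≤ (p.1 * x.1) ^ 2 := by
    have e1 : p.1 ^ 2 = 1 + ‖p.2‖ ^ 2 := by linarith
    have e2 : x.1 ^ 2 = 1 + ‖x.2‖ ^ 2 := by linarith
    rw [mul_pow, e1, e2]
    nlinarith [sq_nonneg (‖p.2‖ - ‖x.2‖)]
  have h5 := le_of_abs_le (abs_le_of_sq_le_sq h4 h3.le)
  linarith

lemma radial_polar {d : ℕ} {p w : Mink d} (hp : p ∈ Hyp d) (hw : w ∈ unitSphere p) {r : ℝ}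
    (hr : 0 ≤ r) : radial p (polar p r w) = r := by
  simp only [radial, polar, mink_add_right, mink_smul_right, hp.1, hw.1]
  simpa using Real.arcosh_cosh hr

lemma angular_polar {d : ℕ} {p w : Mink d} (hp : p ∈ Hyp d) (hw : w ∈ unitSphere p) {r : ℝ}
    (hr : 0 < r) : angular p (polar p r w) = w := by
  rw [angular, radial_polar hp hw hr.le, polar, add_sub_cancel_left, smul_smul,
    inv_mul_cancel₀ (Real.sinh_pos_iff.2 hr).ne', one_smul]

lemma polar_radial_angular {d : ℕ} {p x : Mink d} (h : 0 < radial p x) :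
    polar p (radial p x) (angular p x) = x := by
  rw [polar, angular, smul_smul, mul_inv_cancel₀ (Real.sinh_pos_iff.2 h).ne', one_smul,
    add_sub_cancel]

lemma angular_mem_unitSphere {d : ℕ} {p x : Mink d} (hp : p ∈ Hyp d) (hx : x ∈ Hyp d)
    (h : 0 < radial p x) : angular p x ∈ unitSphere p := by
  have hc : Real.cosh (radial p x) = -mink p x := Real.cosh_arcosh (one_le_neg_mink hp hx)
  have hs := (Real.sinh_pos_iff.2 h).ne'
  have hq := Real.cosh_sq (radial p x)
  have e : x - Real.cosh (radial p x) • p = x + (-Real.cosh (radial p x)) • p := by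
    rw [neg_smul, sub_eq_add_neg]
  have hm : mink p x = -Real.cosh (radial p x) := by linarith
  constructor
  · simp only [angular, e, mink_add_right, mink_smul_right, hp.1, hm]
    ring
  · simp only [angular, e, mink_add_right, mink_smul_right, mink_add_left, mink_smul_left, hp.1,
      hx.1, mink_comm x p, hm]
    field_simp
    linarith

/-- The velocity of `polar p r ω` for moving `(r, ω)` has squared length
`ṙ² + sinh² r ‖ω̇‖²`. -/
lemma mink_polar_velocity {d : ℕ} {p w : Mink d} (hp : p ∈ Hyp d) (hw : w ∈ unitSphere p)
    {w' : Mink d} (h1 : mink p w' = 0) (h2 : mink w w' = 0) (r r' : ℝ) :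
    let v := r' • (Real.sinh r • p + Real.cosh r • w) + Real.sinh r • w'
    mink v v = r' ^ 2 + Real.sinh r ^ 2 * mink w' w' := by
  have hq := Real.cosh_sq r
  simp only [mink_add_right, mink_smul_right, mink_add_left, mink_smul_left, hp.1, hw.1, hw.2,
    mink_comm w p, mink_comm w' p, mink_comm w' w, h1, h2]
  linear_combination r' ^ 2 * hq

/-! ### FLRW spacetimes with `K = -1` -/

/-- The conditions on the scale factor `a : (0,∞) → (0,∞)`. -/
structure IsScaleFactor (a : ℝ → ℝ) : Prop where
  pos : ∀ t, 0 < t → 0 < a t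
  contDiffOn : ContDiffOn ℝ 2 a (Ioi 0)
  tendsto_zero : Tendsto a (𝓝[>] 0) (𝓝 0)

/-- The absence of particle horizons, `∫₀¹ 1/a = ∞`. -/
def NoParticleHorizons (a : ℝ → ℝ) : Prop :=
  ∫⁻ t in Ioc (0 : ℝ) 1, ENNReal.ofReal (1 / a t) = ⊤

/-- `τ(t) = ∫₁ᵗ 1/a`. -/
def tau (a : ℝ → ℝ) (t : ℝ) : ℝ := ∫ s in (1 : ℝ)..t, 1 / a s

/-- The space `ℝ × ℝ^{1,d}` that contains the spacetime `(0,∞) × ℍ^d`. -/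
abbrev Ambient (d : ℕ) : Type := ℝ × Mink d

/-- The manifold `M = (0,∞) × ℍ^d`; the time coordinate `t` is the first component. -/
def spacetime (d : ℕ) : Set (Ambient d) := {z | 0 < z.1 ∧ z.2 ∈ Hyp d}

/-- The Lorentzian metric `g = -dt² + a(t)² g_{ℍ^d}` at the point `z`, applied to the tangent
vectors `v`, `w`. -/
def metric {d : ℕ} (a : ℝ → ℝ) (z v w : Ambient d) : ℝ :=
  -(v.1 * w.1) + a z.1 ^ 2 * mink v.2 w.2

/-- `v` is a future directed timelike tangent vector at `z` (`∂_t` is future directed). -/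
def IsFutureTimelike {d : ℕ} (a : ℝ → ℝ) (z v : Ambient d) : Prop :=
  metric a z v v < 0 ∧ 0 < v.1

/-- `v` is a future directed causal (hence non-zero) tangent vector at `z`. -/
def IsFutureCausal {d : ℕ} (a : ℝ → ℝ) (z v : Ambient d) : Prop :=
  metric a z v v ≤ 0 ∧ 0 < v.1

/-! ### Curves -/

/-- `f` is piecewise `C^n` on the interval `I`: every point of `I` has a one-sided neighbourhood
in `I` on either side on which, endpoints included, `f` is `C^n`. On a compact interval this says
that there are finitely many breakpoints. -/
def PiecewiseContDiffOn {V : Type*} [NormedAddCommGroup V] [NormedSpace ℝ V] (n : WithTop ℕ∞)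
    (f : ℝ → V) (I : Set ℝ) : Prop :=
  ∀ s ∈ I, ∃ ε > 0, ContDiffOn ℝ n f (I ∩ Icc s (s + ε)) ∧ ContDiffOn ℝ n f (I ∩ Icc (s - ε) s)

/-- All right and left tangent vectors of `f` on the interval `I` satisfy `C`. At the endpoints of
`I` only one of them exists. -/
def TangentsSatisfy {V : Type*} [NormedAddCommGroup V] [NormedSpace ℝ V] (C : V → V → Prop)
    (f : ℝ → V) (I : Set ℝ) : Prop :=
  ∀ s ∈ I, ((∃ s' ∈ I, s < s') → C (f s) (derivWithin f (I ∩ Ici s) s)) ∧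
    ((∃ s' ∈ I, s' < s) → C (f s) (derivWithin f (I ∩ Iic s) s))

/-- `γ : I → M` is a future directed timelike (piecewise smooth) curve. -/
def IsFutureTimelikeCurve {d : ℕ} (a : ℝ → ℝ) (γ : ℝ → Ambient d) (I : Set ℝ) : Prop :=
  MapsTo γ I (spacetime d) ∧ PiecewiseContDiffOn ∞ γ I ∧
    TangentsSatisfy (IsFutureTimelike a) γ I

/-- `γ : I → M` is a future directed causal (piecewise `C¹`) curve. -/
def IsFutureCausalCurve {d : ℕ} (a : ℝ → ℝ) (γ : ℝ → Ambient d) (I : Set ℝ) : Prop :=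
  MapsTo γ I (spacetime d) ∧ PiecewiseContDiffOn 1 γ I ∧
    TangentsSatisfy (IsFutureCausal a) γ I

/-- A future directed curve `γ : (0,1] → M` is past inextendible: `γ(s)` does not converge in
`M` as `s → 0`. -/
def IsPastInextendible {d : ℕ} (γ : ℝ → Ambient d) : Prop :=
  ¬ ∃ z ∈ spacetime d, Tendsto γ (𝓝[>] 0) (𝓝 z)

/-- The causal past `J⁻(q, M)`: `q` and all points from which there is a future directed causal
curve to `q`. -/
def causalPast {d : ℕ} (a : ℝ → ℝ) (q : Ambient d) : Set (Ambient d) :=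
  {z | z = q ∨ ∃ (b c : ℝ) (γ : ℝ → Ambient d), b < c ∧ IsFutureCausalCurve a γ (Icc b c) ∧
    γ b = z ∧ γ c = q}

/-! ### Hypersurfaces of constant time and the induced Riemannian distance -/

/-- `Σ_{t₀} = {t = t₀}`. -/
def timeSlice (d : ℕ) (t₀ : ℝ) : Set (Ambient d) := {z ∈ spacetime d | z.1 = t₀}

/-- The length of `σ : [0,1] → M`, for a spacelike curve `σ`. -/
def curveLength {d : ℕ} (a : ℝ → ℝ) (σ : ℝ → Ambient d) : ℝ≥0∞ :=
  ∫⁻ s in Ioo (0 : ℝ) 1, ENNReal.ofReal √(metric a (σ s) (deriv σ s) (deriv σ s))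

/-- The Riemannian distance of `x` and `y` in an open subset `S` of a hypersurface `Σ_{t₀}`, with
respect to the Riemannian metric induced by `g`: the infimum of the lengths of the piecewise `C¹`
curves in `S` from `x` to `y` (`∞` if there are none). -/
def inducedDist {d : ℕ} (a : ℝ → ℝ) (S : Set (Ambient d)) (x y : Ambient d) : ℝ≥0∞ :=
  ⨅ (σ : ℝ → Ambient d) (_ : PiecewiseContDiffOn 1 σ (Icc 0 1)) (_ : MapsTo σ (Icc 0 1) S)
    (_ : σ 0 = x) (_ : σ 1 = y), curveLength a σ

end

end FLRW

/-!
The proof uses the metric `dr² + sinh² r g_{𝕊^{d-1}}` of `ℍ^d` in polar coordinates around `p`: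
a curve whose radius stays large is long as soon as its angle changes by a fixed amount.

A point `(t, x)` whose hyperbolic distance from the spatial position of `q` is at most the conformal
time `τ(t_q) - τ(t)` can be joined to `q` by a radial geodesic run through at constant speed in
conformal time, which is causal (`mem_causalPast_of_radial_le`). Outside `J⁻(q)` the distance from
`q` therefore exceeds `τ(t_q) - τ(t)`. Moving the centre from `q` to `p` changes `cosh r` by at most a
constant factor (`cosh_radial_le_mul`), so `sinh r ≥ c e^{-τ(t)} - 1` on the complement of `J⁻(q)` in
`Σ_t`, with `c > 0` independent of `t` (`le_sinh_radial_of_notMem_causalPast`).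

Hence every curve in that complement has length at least a constant times
`a(t) (c e^{-τ(t)} - 1)` times the norm of the difference of the angular coordinates of its endpoints
(`enorm_angular_sub_le_inducedDist`). The first factor tends to infinity because `a e^{-τ} → ∞` and
`a → 0`; the difference of the angles tends to `ω₂ - ω₁ ≠ 0`. The curves `γᵢ` enter only through the
limits of their angles.
-/

namespace FLRW

/-! ### Geometry of the hyperboloid -/

lemma snd_norm_sq {d : ℕ} {x : Mink d} (hx : x ∈ Hyp d) : ‖x.2‖ ^ 2 = x.1 ^ 2 - 1 := by
  have h := hx.1
  simp only [mink, real_inner_self_eq_norm_sq] at h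
  linarith

lemma snd_norm_lt_fst {d : ℕ} {x : Mink d} (hx : x ∈ Hyp d) : ‖x.2‖ < x.1 :=
  lt_of_pow_lt_pow_left₀ 2 hx.2.le (by rw [snd_norm_sq hx]; linarith)

lemma cosh_radial {d : ℕ} {p x : Mink d} (hp : p ∈ Hyp d) (hx : x ∈ Hyp d) :
    Real.cosh (radial p x) = -mink p x :=
  Real.cosh_arcosh (one_le_neg_mink hp hx)

lemma radial_nonneg {d : ℕ} {p x : Mink d} (hp : p ∈ Hyp d) (hx : x ∈ Hyp d) :
    0 ≤ radial p x :=
  Real.arcosh_nonneg (one_le_neg_mink hp hx)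

/-- The equality case of the reverse Cauchy–Schwarz inequality on the hyperboloid. -/
lemma eq_of_radial_eq_zero {d : ℕ} {p x : Mink d} (hp : p ∈ Hyp d) (hx : x ∈ Hyp d)
    (h : radial p x = 0) : x = p := by
  have h1 : -mink p x = 1 := by rw [← cosh_radial hp hx, h, Real.cosh_zero]
  have h2 : inner ℝ p.2 x.2 = p.1 * x.1 - 1 := by simp only [mink] at h1; linarith
  have h3 : ‖p.2 - x.2‖ ^ 2 ≤ 0 := by
    rw [norm_sub_sq_real, snd_norm_sq hp, snd_norm_sq hx, h2]
    have := abs_real_inner_le_norm p.2 x.2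
    have h4 := sq_le_sq' (abs_le.1 this).1 (abs_le.1 this).2
    rw [mul_pow, snd_norm_sq hp, snd_norm_sq hx, h2] at h4
    nlinarith
  have h5 : p.2 = x.2 := by
    rw [← sub_eq_zero, ← norm_eq_zero]
    exact pow_eq_zero_iff two_ne_zero |>.1 (le_antisymm h3 (sq_nonneg _))
  refine Prod.ext ?_ h5.symm
  have h6 := snd_norm_sq hp
  rw [h5, snd_norm_sq hx] at h6
  exact (pow_left_inj₀ hx.2.le hp.2.le two_ne_zero).1 (by linarith)

/-- Changing the centre of the polar coordinates changes `cosh r` by at most a constant factor.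
This replaces the triangle inequality for the hyperbolic distance. -/
lemma cosh_radial_le_mul {d : ℕ} {p q x : Mink d} (hp : p ∈ Hyp d) (hq : q ∈ Hyp d)
    (hx : x ∈ Hyp d) :
    Real.cosh (radial q x) ≤ 2 * q.1 / (p.1 - ‖p.2‖) * Real.cosh (radial p x) := by
  have h0 := sub_pos.2 (snd_norm_lt_fst hp)
  have hx1 := (snd_norm_lt_fst hx).le
  have h1 : -mink q x ≤ 2 * q.1 * x.1 := by
    have h := neg_le_of_abs_le (abs_real_inner_le_norm q.2 x.2)
    have := mul_le_mul (snd_norm_lt_fst hq).le hx1 (norm_nonneg _) hq.2.le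
    simp only [mink]
    linarith
  have h2 : (p.1 - ‖p.2‖) * x.1 ≤ -mink p x := by
    have h := real_inner_le_norm p.2 x.2
    have := mul_le_mul_of_nonneg_left hx1 (norm_nonneg p.2)
    simp only [mink]
    linarith
  rw [cosh_radial hp hx, cosh_radial hq hx, div_mul_eq_mul_div, le_div_iff₀ h0]
  nlinarith [mul_le_mul_of_nonneg_left h2 (mul_pos two_pos hq.2).le,
    mul_le_mul_of_nonneg_right h1 h0.le]

/-- A vector orthogonal to `p` in Minkowski space satisfies `p₀ |v₀| ≤ |p⃗| |v⃗|`. -/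
lemma fst_mul_abs_le_of_mink_eq_zero {d : ℕ} {p v : Mink d} (hp : p ∈ Hyp d)
    (h : mink p v = 0) : p.1 * |v.1| ≤ ‖p.2‖ * ‖v.2‖ := by
  have h1 : p.1 * v.1 = inner ℝ p.2 v.2 := by simp only [mink] at h; linarith
  rw [← abs_of_pos hp.2, ← abs_mul, h1]
  exact abs_real_inner_le_norm _ _

/-- The Minkowski product is positive definite on `p^⊥`, quantitatively. -/
lemma norm_div_le_sqrt_mink {d : ℕ} {p v : Mink d} (hp : p ∈ Hyp d) (h : mink p v = 0) :
    ‖v‖ / p.1 ≤ √(mink v v) := by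
  have h1 := fst_mul_abs_le_of_mink_eq_zero hp h
  have h2 : p.1 * |v.1| ≤ p.1 * ‖v.2‖ :=
    h1.trans (mul_le_mul_of_nonneg_right (snd_norm_lt_fst hp).le (norm_nonneg _))
  have h3 : ‖v‖ = ‖v.2‖ := by
    rw [Prod.norm_def, Real.norm_eq_abs]
    exact max_eq_right (le_of_mul_le_mul_left h2 hp.2)
  refine Real.le_sqrt_of_sq_le ?_
  rw [h3, div_pow, div_le_iff₀ (pow_pos hp.2 2)]
  have h4 := pow_le_pow_left₀ (by have := hp.2; positivity) h1 2
  rw [mul_pow, mul_pow, sq_abs, snd_norm_sq hp] at h4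
  simp only [mink, real_inner_self_eq_norm_sq]
  nlinarith

lemma polar_mem_Hyp {d : ℕ} {p w : Mink d} (hp : p ∈ Hyp d) (hw : w ∈ unitSphere p) (r : ℝ) :
    polar p r w ∈ Hyp d := by
  constructor
  · simp only [polar, mink_add_right, mink_smul_right, mink_add_left, mink_smul_left, hp.1, hw.1,
      hw.2, mink_comm w p]
    linarith [Real.cosh_sq r]
  · have h1 := fst_mul_abs_le_of_mink_eq_zero hp hw.1
    have h2 : |w.1| < p.1 := by
      have h4 := pow_le_pow_left₀ (by have := hp.2; positivity) h1 2
      have h5 := hw.2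
      simp only [mink, real_inner_self_eq_norm_sq] at h5
      rw [mul_pow, mul_pow, sq_abs, snd_norm_sq hp] at h4
      refine lt_of_pow_lt_pow_left₀ 2 hp.2.le ?_
      rw [sq_abs]
      nlinarith
    have h3 : |Real.sinh r| < Real.cosh r := by
      refine lt_of_pow_lt_pow_left₀ 2 (Real.cosh_pos r).le ?_
      rw [sq_abs, Real.cosh_sq]
      linarith
    have h6 : |Real.sinh r * w.1| < Real.cosh r * p.1 := by
      rw [abs_mul]
      exact mul_lt_mul'' h3 h2 (abs_nonneg _) (abs_nonneg _)
    have h7 := neg_lt_of_abs_lt h6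
    simp only [polar, Prod.fst_add, Prod.smul_fst, smul_eq_mul]
    linarith

/-! ### The causal past contains a ball of radius `τ(t_q) - τ(t)` -/

lemma IsScaleFactor.continuousOn_one_div {a : ℝ → ℝ} (ha : IsScaleFactor a) :
    ContinuousOn (fun s => 1 / a s) (Ioi 0) :=
  continuousOn_const.div ha.contDiffOn.continuousOn fun s hs => (ha.pos s hs).ne'

lemma hasDerivAt_tau {a : ℝ → ℝ} (ha : IsScaleFactor a) {t : ℝ} (ht : 0 < t) :
    HasDerivAt (tau a) (1 / a t) t := by
  have hc := ha.continuousOn_one_div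
  refine intervalIntegral.integral_hasDerivAt_right
    (ContinuousOn.intervalIntegrable (hc.mono fun s hs => ?_))
    (hc.stronglyMeasurableAtFilter isOpen_Ioi t ht) (hc.continuousAt (Ioi_mem_nhds ht))
  exact (lt_min one_pos ht).trans_le hs.1

lemma contDiffOn_tau {a : ℝ → ℝ} (ha : IsScaleFactor a) : ContDiffOn ℝ 1 (tau a) (Ioi 0) := by
  rw [show (1 : WithTop ℕ∞) = 0 + 1 from (zero_add 1).symm,
    contDiffOn_succ_iff_deriv_of_isOpen isOpen_Ioi]
  refine ⟨fun t ht => (hasDerivAt_tau ha ht).differentiableAt.differentiableWithinAt,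
    by simp, ?_⟩
  exact contDiffOn_zero.2 (ha.continuousOn_one_div.congr fun t ht => (hasDerivAt_tau ha ht).deriv)

/-- The graph over the time axis of a curve in `ℍ^d` of speed at most `1 / a` is causal. -/
lemma mem_causalPast_of_curve {d : ℕ} {a : ℝ → ℝ} {η η' : ℝ → Mink d}
    (hη : ∀ s, 0 < s → η s ∈ Hyp d) (hC : ContDiffOn ℝ 1 η (Ioi 0))
    (hd : ∀ s, 0 < s → HasDerivAt η (η' s) s)
    (hs : ∀ s, 0 < s → a s ^ 2 * mink (η' s) (η' s) ≤ 1)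
    {b c : ℝ} (hb : 0 < b) (hbc : b < c) : (b, η b) ∈ causalPast a (c, η c) := by
  have hsub : Icc b c ⊆ Ioi 0 := fun s hs => hb.trans_le hs.1
  have hC' : ContDiffOn ℝ 1 (fun s => (s, η s)) (Ioi 0) := contDiffOn_id.prodMk hC
  refine Or.inr ⟨b, c, fun s => (s, η s), hbc, ⟨fun s hs => ⟨hsub hs, hη s (hsub hs)⟩,
    fun s hs => ⟨1, one_pos, hC'.mono (inter_subset_left.trans hsub),
      hC'.mono (inter_subset_left.trans hsub)⟩, fun s hsI => ?_⟩, rfl, rfl⟩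
  have hs0 : 0 < s := hsub hsI
  have hder : HasDerivAt (fun s => (s, η s)) (1, η' s) s := (hasDerivAt_id s).prodMk (hd s hs0)
  have hcaus : IsFutureCausal a (s, η s) (1, η' s) := by
    refine ⟨?_, one_pos⟩
    have := hs s hs0
    simp only [metric]
    linarith
  constructor
  · rintro ⟨s', hs', hlt⟩
    have he : Icc b c ∩ Ici s = Icc s c := by
      ext y; simp only [mem_inter_iff, mem_Icc, mem_Ici]; have := hsI.1; grind
    rw [he, hder.hasDerivWithinAt.derivWithin
      (uniqueDiffOn_Icc (hlt.trans_le hs'.2) s ⟨le_rfl, hsI.2⟩)]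
    exact hcaus
  · rintro ⟨s', hs', hlt⟩
    have he : Icc b c ∩ Iic s = Icc b s := by
      ext y; simp only [mem_inter_iff, mem_Icc, mem_Iic]; have := hsI.2; grind
    rw [he, hder.hasDerivWithinAt.derivWithin
      (uniqueDiffOn_Icc (hs'.1.trans_lt hlt) s ⟨hsI.1, le_rfl⟩)]
    exact hcaus

/-- A point at time `t` whose hyperbolic distance from `x_q` is at most the conformal time
`τ(t_q) - τ(t)` lies in the causal past of `q`. -/
lemma mem_causalPast_of_radial_le {d : ℕ} {a : ℝ → ℝ} (ha : IsScaleFactor a) {q : Ambient d}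
    (hq : q ∈ spacetime d) {t : ℝ} (ht : 0 < t) (htq : t < q.1) {x : Mink d} (hx : x ∈ Hyp d)
    (hr : radial q.2 x ≤ tau a q.1 - tau a t) : (t, x) ∈ causalPast a q := by
  rcases (radial_nonneg hq.2 hx).eq_or_lt with h0 | h0
  · -- at distance zero the angular coordinate is meaningless; the curve is `s ↦ (s, x_q)`
    rw [eq_of_radial_eq_zero hq.2 hx h0.symm]
    exact mem_causalPast_of_curve (η := fun _ => q.2) (η' := fun _ => 0) (fun _ _ => hq.2)
      contDiffOn_const (fun s _ => hasDerivAt_const s _) (fun s _ => by simp [mink]) ht htq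
  · -- the radial geodesic from `x` to `x_q`, run through at constant speed in conformal time
    set ρ := radial q.2 x with hρ
    set R := tau a q.1 - tau a t with hR
    set w := angular q.2 x with hwdef
    have hw : w ∈ unitSphere q.2 := angular_mem_unitSphere hq.2 hx h0
    have hR0 : 0 < R := h0.trans_le hr
    set f : ℝ → ℝ := fun s => ρ / R * (tau a q.1 - tau a s) with hf
    have hfd : ∀ s, 0 < s → HasDerivAt f (ρ / R * -(1 / a s)) s := fun s hs =>
      ((hasDerivAt_tau ha hs).const_sub _).const_mul _
    have hfC : ContDiffOn ℝ 1 f (Ioi 0) :=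
      contDiffOn_const.mul (contDiffOn_const.sub (contDiffOn_tau ha))
    have hft : f t = ρ := div_mul_cancel₀ _ hR0.ne'
    have key := mem_causalPast_of_curve (a := a) (η := fun s => polar q.2 (f s) w)
      (η' := fun s => (ρ / R * -(1 / a s)) •
        (Real.sinh (f s) • q.2 + Real.cosh (f s) • w) + Real.sinh (f s) • (0 : Mink d))
      (fun s _ => polar_mem_Hyp hq.2 hw _) ?_ ?_ ?_ ht htq
    · simp only [hft] at key
      rw [hρ, hwdef, polar_radial_angular h0] at key
      simpa [hf, polar] using key
    · exact ((Real.contDiff_cosh.comp_contDiffOn hfC).smul contDiffOn_const).add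
        ((Real.contDiff_sinh.comp_contDiffOn hfC).smul contDiffOn_const)
    · intro s hs
      have h1 := ((hfd s hs).cosh.smul_const q.2).add ((hfd s hs).sinh.smul_const w)
      refine h1.congr_deriv ?_
      module
    · intro s hs
      have hv := mink_polar_velocity hq.2 hw (w' := 0) (by simp [mink]) (by simp [mink]) (f s)
        (ρ / R * -(1 / a s))
      simp only at hv
      have ha0 := ha.pos s hs
      rw [hv, show mink (0 : Mink d) 0 = 0 by simp [mink], mul_zero, add_zero,
        show a s ^ 2 * (ρ / R * -(1 / a s)) ^ 2 = (ρ / R) ^ 2 by field_simp]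
      exact pow_le_one₀ (by positivity) ((div_le_one hR0).2 hr)

/-- Outside the causal past of `q`, `sinh r` at time `t` grows like `e^{-τ(t)}`. -/
lemma le_sinh_radial_of_notMem_causalPast {d : ℕ} {a : ℝ → ℝ} (ha : IsScaleFactor a)
    {p : Mink d} (hp : p ∈ Hyp d) {q : Ambient d} (hq : q ∈ spacetime d) {t : ℝ} (ht : 0 < t)
    (htq : t < q.1) {x : Mink d} (hx : x ∈ Hyp d) (hn : (t, x) ∉ causalPast a q) :
    (p.1 - ‖p.2‖) / (4 * q.2.1) * Real.exp (tau a q.1 - tau a t) - 1 ≤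
      Real.sinh (radial p x) := by
  have h1 : tau a q.1 - tau a t < radial q.2 x := by
    by_contra! h
    exact hn (mem_causalPast_of_radial_le ha hq ht htq hx h)
  have h2 := cosh_radial_le_mul hp hq.2 hx
  have h3 : Real.exp (tau a q.1 - tau a t) ≤ 2 * Real.cosh (radial q.2 x) := by
    rw [Real.cosh_eq]
    linarith [Real.exp_le_exp.2 h1.le, Real.exp_pos (-radial q.2 x)]
  have h4 : Real.cosh (radial p x) ≤ Real.sinh (radial p x) + 1 := by
    have := Real.cosh_sub_sinh (radial p x)
    have := Real.exp_le_one_iff.2 (neg_nonpos.2 (radial_nonneg hp hx))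
    linarith
  have h0 := sub_pos.2 (snd_norm_lt_fst hp)
  have hq0 := hq.2.2
  have h5 : (p.1 - ‖p.2‖) / (4 * q.2.1) * Real.exp (tau a q.1 - tau a t) ≤
      Real.cosh (radial p x) := by
    generalize p.1 - ‖p.2‖ = δ at h0 h2 ⊢
    calc δ / (4 * q.2.1) * Real.exp (tau a q.1 - tau a t)
        ≤ δ / (4 * q.2.1) * (2 * (2 * q.2.1 / δ * Real.cosh (radial p x))) :=
          mul_le_mul_of_nonneg_left (by linarith) (by positivity)
      _ = Real.cosh (radial p x) := by field_simp; ring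
  linarith

/-! ### Lengths of curves and angular displacement -/

lemma one_lt_neg_mink_of_radial_pos {d : ℕ} {p x : Mink d} (hp : p ∈ Hyp d) (hx : x ∈ Hyp d)
    (h : 0 < radial p x) : 1 < -mink p x := by
  rw [← cosh_radial hp hx]
  exact Real.one_lt_cosh.2 h.ne'

lemma contDiff_mink {d : ℕ} (p : Mink d) {n : WithTop ℕ∞} : ContDiff ℝ n (mink p) :=
  (contDiff_const.mul contDiff_fst).neg.add (contDiff_const.inner ℝ contDiff_snd)

lemma contDiffAt_radial {d : ℕ} {p x : Mink d} (h : 1 < -mink p x) {n : WithTop ℕ∞} :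
    ContDiffAt ℝ n (radial p) x :=
  (Real.contDiffAt_arcosh h).comp x (contDiff_mink p).neg.contDiffAt

lemma contDiffAt_angular {d : ℕ} {p x : Mink d} (h : 1 < -mink p x) {n : WithTop ℕ∞} :
    ContDiffAt ℝ n (angular p) x := by
  have hr : ContDiffAt ℝ n (radial p) x := contDiffAt_radial h
  have h0 : Real.sinh (radial p x) ≠ 0 := (Real.sinh_pos_iff.2 (Real.arcosh_pos h)).ne'
  exact ((Real.contDiff_sinh.contDiffAt.comp x hr).inv h0).smul
    (contDiffAt_id.sub ((Real.contDiff_cosh.contDiffAt.comp x hr).smul contDiffAt_const))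

lemma hasDerivAt_prod_fst {E F : Type*} [NormedAddCommGroup E] [NormedSpace ℝ E]
    [NormedAddCommGroup F] [NormedSpace ℝ F] {f : ℝ → E × F} {f' : E × F} {s : ℝ}
    (hf : HasDerivAt f f' s) : HasDerivAt (fun s => (f s).1) f'.1 s := by
  simpa using hf.hasFDerivAt.fst.hasDerivAt

lemma hasDerivAt_prod_snd {E F : Type*} [NormedAddCommGroup E] [NormedSpace ℝ E]
    [NormedAddCommGroup F] [NormedSpace ℝ F] {f : ℝ → E × F} {f' : E × F} {s : ℝ}
    (hf : HasDerivAt f f' s) : HasDerivAt (fun s => (f s).2) f'.2 s := by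
  simpa using hf.hasFDerivAt.snd.hasDerivAt

lemma hasDerivAt_mink {d : ℕ} {f g : ℝ → Mink d} {f' g' : Mink d} {s : ℝ}
    (hf : HasDerivAt f f' s) (hg : HasDerivAt g g' s) :
    HasDerivAt (fun s => mink (f s) (g s)) (mink f' (g s) + mink (f s) g') s := by
  have h := ((hasDerivAt_prod_fst hf).mul (hasDerivAt_prod_fst hg)).neg.add
    ((hasDerivAt_prod_snd hf).inner ℝ (hasDerivAt_prod_snd hg))
  refine h.congr_deriv ?_
  simp only [mink]
  ring

/-- A curve in `ℍ^d` moves at least as fast as `sinh r` times its angular coordinate; the factor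
`1 / p₀` compares the ambient norm with the Minkowski product on `p^⊥`. -/
lemma sinh_mul_norm_deriv_angular_le {d : ℕ} {p : Mink d} (hp : p ∈ Hyp d) {x : ℝ → Mink d}
    {s : ℝ} (hx : DifferentiableAt ℝ x s) (hH : ∀ᶠ y in 𝓝 s, x y ∈ Hyp d)
    (hr : ∀ᶠ y in 𝓝 s, 0 < radial p (x y)) :
    Real.sinh (radial p (x s)) * (‖deriv (fun y => angular p (x y)) s‖ / p.1) ≤
      √(mink (deriv x s) (deriv x s)) := by
  have h1 := one_lt_neg_mink_of_radial_pos hp hH.self_of_nhds hr.self_of_nhds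
  have hrd : DifferentiableAt ℝ (fun y => radial p (x y)) s :=
    ((contDiffAt_radial (n := 1) h1).differentiableAt one_ne_zero).comp s hx
  have hwd : DifferentiableAt ℝ (fun y => angular p (x y)) s :=
    ((contDiffAt_angular (n := 1) h1).differentiableAt one_ne_zero).comp s hx
  set r := fun y => radial p (x y)
  set w := fun y => angular p (x y)
  have hw : ∀ᶠ y in 𝓝 s, w y ∈ unitSphere p := by
    filter_upwards [hH, hr] with y h2 h3 using angular_mem_unitSphere hp h2 h3
  have hws := hw.self_of_nhds
  -- the velocity of the angle is tangent to the unit sphere in `p^⊥`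
  have e1 : mink p (deriv w s) = 0 := by
    have h2 := hasDerivAt_mink (hasDerivAt_const s p) hwd.hasDerivAt
    have h3 := h2.unique ((hasDerivAt_const s (0 : ℝ)).congr_of_eventuallyEq
      (hw.mono fun y hy => hy.1))
    simpa [mink] using h3
  have e2 : mink (w s) (deriv w s) = 0 := by
    have h2 := hasDerivAt_mink hwd.hasDerivAt hwd.hasDerivAt
    have h3 := h2.unique ((hasDerivAt_const s (1 : ℝ)).congr_of_eventuallyEq
      (hw.mono fun y hy => hy.2))
    rw [mink_comm (deriv w s)] at h3
    linarith
  have e3 : deriv x s = deriv r s • (Real.sinh (r s) • p + Real.cosh (r s) • w s) +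
      Real.sinh (r s) • deriv w s := by
    have h2 := (hrd.hasDerivAt.cosh.smul_const p).add (hrd.hasDerivAt.sinh.smul hwd.hasDerivAt)
    have h3 := (h2.congr_of_eventuallyEq (f₁ := x)
      (hr.mono fun y hy => (polar_radial_angular hy).symm)).deriv
    rw [h3]
    module
  have hv := mink_polar_velocity hp hws e1 e2 (r s) (deriv r s)
  simp only at hv
  have hs0 := (Real.sinh_pos_iff.2 hr.self_of_nhds).le
  rw [e3, hv]
  calc Real.sinh (r s) * (‖deriv w s‖ / p.1)
      ≤ Real.sinh (r s) * √(mink (deriv w s) (deriv w s)) :=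
        mul_le_mul_of_nonneg_left (norm_div_le_sqrt_mink hp e1) hs0
    _ = √(Real.sinh (r s) ^ 2 * mink (deriv w s) (deriv w s)) := by
        rw [Real.sqrt_mul (sq_nonneg _), Real.sqrt_sq hs0]
    _ ≤ _ := Real.sqrt_le_sqrt (by nlinarith [sq_nonneg (deriv r s)])

/-- The length estimate on a `C¹` piece of a curve. -/
lemma enorm_angular_sub_le_of_contDiffOn {d : ℕ} {a : ℝ → ℝ} {p : Mink d} (hp : p ∈ Hyp d)
    {t m : ℝ} (hat : 0 < a t) (hm : 0 < m) {σ : ℝ → Ambient d} {u v : ℝ} (huv : u ≤ v)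
    (hσ : ContDiffOn ℝ 1 σ (Icc u v)) (hS : MapsTo σ (Icc u v) (timeSlice d t))
    (hsinh : ∀ s ∈ Icc u v, m ≤ Real.sinh (radial p (σ s).2)) :
    ENNReal.ofReal (a t * m / p.1) * ‖angular p (σ v).2 - angular p (σ u).2‖ₑ ≤
      ∫⁻ s in Ioo u v, ENNReal.ofReal √(metric a (σ s) (deriv σ s) (deriv σ s)) := by
  have hrpos : ∀ s ∈ Icc u v, 0 < radial p (σ s).2 := fun s hs =>
    Real.sinh_pos_iff.1 (hm.trans_le (hsinh s hs))
  have hω : ContDiffOn ℝ 1 (fun s => angular p (σ s).2) (Icc u v) := fun s hs =>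
    ContDiffAt.comp_contDiffWithinAt (f := fun s => (σ s).2) (g := angular p) s
      (contDiffAt_angular (one_lt_neg_mink_of_radial_pos hp (hS hs).1.2 (hrpos s hs)))
      (hσ s hs).snd
  refine (mul_le_mul_right (enorm_sub_le_lintegral_deriv_of_contDiffOn_Icc hω huv) _).trans ?_
  rw [← lintegral_const_mul' _ _ ENNReal.ofReal_ne_top, ← restrict_Ioo_eq_restrict_Icc]
  refine setLIntegral_mono' measurableSet_Ioo fun s hs => ?_
  have hnb : Icc u v ∈ 𝓝 s := Icc_mem_nhds hs.1 hs.2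
  have hsI := Ioo_subset_Icc_self hs
  have hd : DifferentiableAt ℝ σ s := ((hσ s hsI).contDiffAt hnb).differentiableAt one_ne_zero
  have h1 : (deriv σ s).1 = 0 :=
    (hasDerivAt_prod_fst hd.hasDerivAt).unique ((hasDerivAt_const s t).congr_of_eventuallyEq
      (by filter_upwards [hnb] with y hy using (hS hy).2))
  have h2 := sinh_mul_norm_deriv_angular_le hp hd.snd
    (by filter_upwards [hnb] with y hy using (hS hy).1.2)
    (by filter_upwards [hnb] with y hy using hrpos y hy)
  rw [(hasDerivAt_prod_snd hd.hasDerivAt).deriv] at h2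
  rw [← ofReal_norm, ← ENNReal.ofReal_mul (by have := hp.2; positivity)]
  refine ENNReal.ofReal_le_ofReal ?_
  have h3 : metric a (σ s) (deriv σ s) (deriv σ s) =
      a t ^ 2 * mink (deriv σ s).2 (deriv σ s).2 := by
    simp only [metric, h1, (hS hsI).2]
    ring
  rw [h3, Real.sqrt_mul (sq_nonneg _), Real.sqrt_sq hat.le]
  have h4 : m * (‖deriv (fun y => angular p (σ y).2) s‖ / p.1) ≤
      √(mink (deriv σ s).2 (deriv σ s).2) :=
    (mul_le_mul_of_nonneg_right (hsinh s hsI) (div_nonneg (norm_nonneg _) hp.2.le)).trans h2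
  calc _ = a t * (m * (‖deriv (fun y => angular p (σ y).2) s‖ / p.1)) := by ring
    _ ≤ _ := mul_le_mul_of_nonneg_left h4 hat.le

/-- A transitive relation that holds on the `C^n` pieces of a piecewise `C^n` function on `[0,1]`
holds between the endpoints. -/
lemma PiecewiseContDiffOn.of_pieces {V : Type*} [NormedAddCommGroup V] [NormedSpace ℝ V]
    {n : WithTop ℕ∞} {f : ℝ → V} (hf : PiecewiseContDiffOn n f (Icc 0 1)) {P : ℝ → ℝ → Prop}
    (htrans : ∀ u v w, u ≤ v → v ≤ w → P u v → P v w → P u w)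
    (hpiece : ∀ u v, 0 ≤ u → u ≤ v → v ≤ 1 → ContDiffOn ℝ n f (Icc u v) → P u v) : P 0 1 := by
  choose! ε hε hR hL using hf
  have hloc : ∀ s ∈ Icc (0 : ℝ) 1, ∀ u v, 0 ≤ u → u ≤ v → v ≤ 1 → s - ε s < u → v < s + ε s →
      P u v := by
    intro s hs u v hu huv hv h1 h2
    have hright : ∀ u v, s ≤ u → u ≤ v → v ≤ 1 → v < s + ε s → P u v := fun u v h h' h'' h3 =>
      hpiece u v (hs.1.trans h) h' h'' ((hR s hs).mono fun y hy =>
        ⟨⟨hs.1.trans (h.trans hy.1), hy.2.trans h''⟩, h.trans hy.1, hy.2.trans h3.le⟩)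
    have hleft : ∀ u v, 0 ≤ u → u ≤ v → v ≤ s → s - ε s < u → P u v := fun u v h h' h'' h3 =>
      hpiece u v h h' (h''.trans hs.2) ((hL s hs).mono fun y hy =>
        ⟨⟨h.trans hy.1, hy.2.trans (h''.trans hs.2)⟩, h3.le.trans hy.1, hy.2.trans h''⟩)
    -- `[u, v]` lies on one side of `s`, or is cut at `s` into two pieces
    rcases le_total s u with h | h
    · exact hright u v h huv hv h2
    rcases le_total v s with h' | h'
    · exact hleft u v hu huv h' h1
    exact htrans u s v h h' (hleft u s hu h le_rfl h1) (hright s v le_rfl h' hv h2)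
  obtain ⟨t, ht0, htm, ⟨N, hN⟩, htc⟩ := exists_monotone_Icc_subset_open_cover_Icc
    (zero_le_one' ℝ) (c := fun s : Icc (0 : ℝ) 1 =>
      {y | s.1 - ε s.1 < y.1 ∧ y.1 < s.1 + ε s.1})
    (fun s => (isOpen_lt continuous_const continuous_subtype_val).inter
      (isOpen_lt continuous_subtype_val continuous_const))
    (fun y _ => mem_iUnion.2 ⟨y, by have := hε y y.2; constructor <;> linarith⟩)
  have hstep : ∀ k, P (t k) (t (k + 1)) := by
    intro k
    obtain ⟨s, hs⟩ := htc k
    have hle := htm k.le_succ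
    exact hloc s s.2 _ _ (t k).2.1 hle (t (k + 1)).2.2 (hs ⟨le_rfl, hle⟩).1 (hs ⟨hle, le_rfl⟩).2
  have hall : ∀ k, P 0 (t k) := by
    intro k
    induction k with
    | zero =>
      rw [ht0]
      exact hloc 0 (by simp) 0 0 le_rfl le_rfl zero_le_one
        (by linarith [hε 0 (by simp)]) (by linarith [hε 0 (by simp)])
    | succ k ih => exact htrans _ _ _ (t k).2.1 (htm k.le_succ) ih (hstep k)
  have := hall N
  rwa [hN N le_rfl] at this

/-- In a slice, while `sinh r ≥ m`, a curve is at least as long as `a m / p₀` times its angular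
displacement in the ambient norm. -/
lemma enorm_angular_sub_le_curveLength {d : ℕ} {a : ℝ → ℝ} {p : Mink d} (hp : p ∈ Hyp d)
    {t m : ℝ} (hat : 0 < a t) (hm : 0 < m) {σ : ℝ → Ambient d}
    (hσ : PiecewiseContDiffOn 1 σ (Icc 0 1)) (hS : MapsTo σ (Icc 0 1) (timeSlice d t))
    (hsinh : ∀ s ∈ Icc (0 : ℝ) 1, m ≤ Real.sinh (radial p (σ s).2)) :
    ENNReal.ofReal (a t * m / p.1) * ‖angular p (σ 1).2 - angular p (σ 0).2‖ₑ ≤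
      curveLength a σ := by
  refine hσ.of_pieces (P := fun u v =>
    ENNReal.ofReal (a t * m / p.1) * ‖angular p (σ v).2 - angular p (σ u).2‖ₑ ≤
      ∫⁻ s in Ioo u v, ENNReal.ofReal √(metric a (σ s) (deriv σ s) (deriv σ s))) ?_ ?_
  · intro u v w huv hvw h1 h2
    have hdisj : Disjoint (Ioo u v) (Ioo v w) :=
      disjoint_left.2 fun y hy hy' => hy.2.not_gt hy'.1
    calc _ ≤ ENNReal.ofReal (a t * m / p.1) * (‖angular p (σ v).2 - angular p (σ u).2‖ₑ +
          ‖angular p (σ w).2 - angular p (σ v).2‖ₑ) := by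
          gcongr
          rw [← sub_add_sub_cancel' (angular p (σ v).2) (angular p (σ u).2)]
          exact enorm_add_le _ _
      _ ≤ _ := by rw [mul_add]; exact add_le_add h1 h2
      _ = _ := (lintegral_union measurableSet_Ioo hdisj).symm
      _ ≤ _ := lintegral_mono_set (union_subset (Ioo_subset_Ioo_right hvw)
          (Ioo_subset_Ioo_left huv))
  · intro u v hu huv hv hC
    have hsub : Icc u v ⊆ Icc 0 1 := Icc_subset_Icc hu hv
    exact enorm_angular_sub_le_of_contDiffOn hp hat hm huv hC (hS.mono_left hsub)
      fun s hs => hsinh s (hsub hs)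

/-- The lower bound for the distance in a time slice outside the causal past of `q`. -/
lemma enorm_angular_sub_le_inducedDist {d : ℕ} {a : ℝ → ℝ} (ha : IsScaleFactor a)
    {p : Mink d} (hp : p ∈ Hyp d) {q : Ambient d} (hq : q ∈ spacetime d) {t : ℝ} (ht : 0 < t)
    (htq : t < q.1)
    (hm : 0 < (p.1 - ‖p.2‖) / (4 * q.2.1) * Real.exp (tau a q.1 - tau a t) - 1)
    (x y : Ambient d) :
    ENNReal.ofReal
        (a t * ((p.1 - ‖p.2‖) / (4 * q.2.1) * Real.exp (tau a q.1 - tau a t) - 1) / p.1) *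
        ‖angular p y.2 - angular p x.2‖ₑ ≤
      inducedDist a (timeSlice d t \ causalPast a q) x y := by
  refine le_iInf fun σ => le_iInf fun hσ => le_iInf fun hS => le_iInf fun h0 => le_iInf fun h1 => ?_
  rw [← h0, ← h1]
  refine enorm_angular_sub_le_curveLength hp (ha.pos t ht) hm hσ (fun s hs => (hS hs).1)
    fun s hs => ?_
  obtain ⟨⟨hs1, hs2⟩, hs3⟩ := hS hs
  refine le_sinh_radial_of_notMem_causalPast ha hp hq ht htq hs1.2 ?_
  rwa [← hs2]

/-! ### Divergence of the lower bound -/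

lemma tendsto_mul_exp_tau {a : ℝ → ℝ} (ha : IsScaleFactor a)
    (hgrowth : Tendsto (fun t => a t * Real.exp (∫ s in t..1, 1 / a s)) (𝓝[>] 0) atTop)
    {c : ℝ} (hc : 0 < c) (T : ℝ) :
    Tendsto (fun t => a t * (c * Real.exp (T - tau a t) - 1)) (𝓝[>] 0) atTop := by
  have h := (hgrowth.const_mul_atTop (mul_pos hc (Real.exp_pos T))).atTop_add
    ha.tendsto_zero.neg
  refine h.congr fun t => ?_
  rw [show T - tau a t = T + ∫ s in t..1, 1 / a s by
    rw [tau, intervalIntegral.integral_symm]; ring, Real.exp_add]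
  ring

end FLRW

theorem proposition3p13 (d : ℕ) (hd : 2 ≤ d) (a : ℝ → ℝ) (ha : FLRW.IsScaleFactor a)
    (hhor : FLRW.NoParticleHorizons a)
    (hgrowth : Tendsto (fun t => a t * Real.exp (∫ s in t..1, 1 / a s)) (𝓝[>] 0) atTop)
    (p : FLRW.Mink d) (hp : p ∈ FLRW.Hyp d)
    (γ₁ γ₂ : ℝ → FLRW.Ambient d)
    (hγ₁ : FLRW.IsFutureTimelikeCurve a γ₁ (Ioc 0 1))
    (hγ₂ : FLRW.IsFutureTimelikeCurve a γ₂ (Ioc 0 1))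
    (hinext₁ : FLRW.IsPastInextendible γ₁) (hinext₂ : FLRW.IsPastInextendible γ₂)
    (hparam₁ : ∀ s ∈ Ioc (0 : ℝ) 1, (γ₁ s).1 = s)
    (hparam₂ : ∀ s ∈ Ioc (0 : ℝ) 1, (γ₂ s).1 = s)
    (u₁ u₂ : ℝ)
    (hu₁ : Tendsto (fun s => FLRW.radial p (γ₁ s).2 + FLRW.tau a (γ₁ s).1) (𝓝[>] 0) (𝓝 u₁))
    (hu₂ : Tendsto (fun s => FLRW.radial p (γ₂ s).2 + FLRW.tau a (γ₂ s).1) (𝓝[>] 0) (𝓝 u₂))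
    (ω₁ ω₂ : FLRW.Mink d) (hω₁ : ω₁ ∈ FLRW.unitSphere p) (hω₂ : ω₂ ∈ FLRW.unitSphere p)
    (hlim₁ : Tendsto (fun s => FLRW.angular p (γ₁ s).2) (𝓝[>] 0) (𝓝 ω₁))
    (hlim₂ : Tendsto (fun s => FLRW.angular p (γ₂ s).2) (𝓝[>] 0) (𝓝 ω₂))
    (hω : ω₁ ≠ ω₂)
    (q : FLRW.Ambient d) (hq : q ∈ FLRW.spacetime d)
    (hq₁ : ∀ s ∈ Ioc (0 : ℝ) 1, γ₁ s ∉ FLRW.causalPast a q)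
    (hq₂ : ∀ s ∈ Ioc (0 : ℝ) 1, γ₂ s ∉ FLRW.causalPast a q) :
    Tendsto
      (fun t₀ => FLRW.inducedDist a (FLRW.timeSlice d t₀ \ FLRW.causalPast a q) (γ₁ t₀) (γ₂ t₀))
      (𝓝[>] 0) (𝓝 ⊤) := by
  have hc : 0 < (p.1 - ‖p.2‖) / (4 * q.2.1) :=
    div_pos (sub_pos.2 (FLRW.snd_norm_lt_fst hp)) (mul_pos four_pos hq.2.2)
  have hgrow := FLRW.tendsto_mul_exp_tau ha hgrowth hc (FLRW.tau a q.1)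
  have hang : Tendsto
      (fun t => ‖FLRW.angular p (γ₂ t).2 - FLRW.angular p (γ₁ t).2‖) (𝓝[>] 0)
      (𝓝 ‖ω₂ - ω₁‖) := (hlim₂.sub hlim₁).norm
  have hprod := ENNReal.tendsto_ofReal_atTop.comp
    ((hgrow.atTop_div_const hp.2).atTop_mul_pos (norm_pos_iff.2 (sub_ne_zero.2 hω.symm)) hang)
  refine tendsto_nhds_top_mono hprod ?_
  filter_upwards [self_mem_nhdsWithin, nhdsWithin_le_nhds (Iio_mem_nhds hq.1),
    hgrow.eventually_gt_atTop 0] with t ht htq hpos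
  have hm := pos_of_mul_pos_right hpos (ha.pos t ht).le
  refine le_trans (le_of_eq ?_)
    (FLRW.enorm_angular_sub_le_inducedDist ha hp hq ht htq hm (γ₁ t) (γ₂ t))
  rw [← ofReal_norm, ← ENNReal.ofReal_mul (div_nonneg hpos.le hp.2.le)]
  rfl
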